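/- **Setting.** Let $\mathbf L$ be a finite set of latent and $\mathbf X$ a finite set of observed discrete random variables, $\mathbf V=\mathbf L\cup\mathbf X$, each variable having at least two possible values; write $\mathrm{supp}(V)$ for the set of values that $V$ takes with positive probability. Every value of every variable has positive probability, and so does every joint configuration of the latent variables. Let $\mathcal G$ be a directed acyclic graph on $\mathbf V$. An observed variable $X$ is a *pure child* of a latent variable $L$ if $L\to X$ is the only edge of $\mathcal G$ at $X$. The model is a *discrete latent structure model*: (1) there is no edge between observed variables; (2) each latent variable has at least three pure children; (3) $|\mathrm{supp}(X)|>|\mathrm{supp}(L)|$ for all $X\in\mathbf X$, $L\in\mathbf L$. Assume moreover: * *(Causal Markov)* each variable is independent of its non-descendants (other than itself and its parents) given its parents in $\mathcal G$; * *(Faithfulness)* every conditional independence $\mathbf A\perp\mathbf B\mid\mathbf Z$ between pairwise disjoint sets of variables that holds in the distribution corresponds to a d-separation in $\mathcal G$; * *(Full Rank)* for each $X\in\mathbf X$ the columns $\mathbb P(X=\cdot\mid \mathrm{Pa}_X=c)$ of its conditional probability table are linearly independent. For a set $\mathbf S$ of observed variables let $\mathcal T_{(\mathbf S)}$ be the tensor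 of their joint probability mass function, with one mode for each variable in $\mathbf S$. The rank of a tensor is the least number of outer products of vectors that sum to it. **Proposition.** Let $L_i\ne L_j$ be latent variables and $\mathbf L_p\subseteq\mathbf L\setminus\{L_i,L_j\}$. Let $X_i$ and $X_j$ be pure children of $L_i$ and $L_j$, respectively. Let $\mathbf X_{p1},\mathbf X_{p2}\subseteq\mathbf X$ be disjoint sets with $|\mathbf X_{p1}|=|\mathbf X_{p2}|=|\mathbf L_p|$, each consisting of pure children of members of $\mathbf L_p$ and containing a child of each member of $\mathbf L_p$. Then $L_i$ and $L_j$ are conditionally independent given $\mathbf L_p$ if and only if $$\mathrm{Rank}\bigl(\mathcal T_{(X_i,X_j,\mathbf X_{p1},\mathbf X_{p2})}\bigr)=\prod_{L\in\mathbf L_p}|\mathrm{supp}(L)|,$$ and likewise $\mathbf L_p$ d-separates $L_i$ and $L_j$ in $\mathcal G$ if and only if this equality holds. -/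

import Mathlib

namespace DiscreteLatent

noncomputable section

/-! ### Discrete distributions -/

section Distribution

variable {V : Type*} [Fintype V]

/-- Joint configurations of finitely many discrete variables, `v` taking `dim v` values. -/
abbrev Config (dim : V → ℕ) : Type _ := ∀ v, Fin (dim v)

open Classical in
/-- The probability of the event `E` under the joint probability mass function `p`. -/
def prob {dim : V → ℕ} (p : Config dim → ℝ) (E : Config dim → Prop) : ℝ :=
  ∑ v with E v, p v

/-- `p` is a probability mass function. -/
def IsPMF {dim : V → ℕ} (p : Config dim → ℝ) : Prop :=
  (∀ v, 0 ≤ p v) ∧ prob p (fun _ => True) = 1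

/-- `ℙ(V_S = s_S)`; only the values of `s` on `S` matter. -/
def marginal {dim : V → ℕ} (p : Config dim → ℝ) (S : Set V) (s : Config dim) : ℝ :=
  prob p (fun v => ∀ u ∈ S, v u = s u)

/-- The set of values that the variable `u` takes with positive probability. -/
def support {dim : V → ℕ} (p : Config dim → ℝ) (u : V) : Set (Fin (dim u)) :=
  {a | 0 < prob p (fun v => v u = a)}

/-- Conditional independence `V_A ⫫ V_B | V_C` of (disjoint) sets of discrete variables:
`ℙ(a, b, c) ℙ(c) = ℙ(a, c) ℙ(b, c)` for all values. -/
def CondIndep {dim : V → ℕ} (p : Config dim → ℝ) (A B C : Set V) : Prop :=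
  ∀ s, marginal p (A ∪ B ∪ C) s * marginal p C s = marginal p (A ∪ C) s * marginal p (B ∪ C) s

end Distribution

/-! ### Directed acyclic graphs -/

section Graph

variable {V : Type*}

def IsAcyclic (G : Digraph V) : Prop := ∀ v, ¬ Relation.TransGen G.Adj v v

def parents (G : Digraph V) (v : V) : Set V := {u | G.Adj u v}

/-- The (proper) descendants of `v`. -/
def descendants (G : Digraph V) (v : V) : Set V := {u | Relation.TransGen G.Adj v u}

/-- `π 0, …, π n` is a path: consecutive nodes are adjacent, in either direction. -/
def IsPath (G : Digraph V) (n : ℕ) (π : ℕ → V) : Prop :=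
  ∀ i < n, G.Adj (π i) (π (i + 1)) ∨ G.Adj (π (i + 1)) (π i)

/-- The node `π (i + 1)` is a collider on the path `π`. -/
def IsCollider (G : Digraph V) (π : ℕ → V) (i : ℕ) : Prop :=
  G.Adj (π i) (π (i + 1)) ∧ G.Adj (π (i + 2)) (π (i + 1))

/-- The path `π 0, …, π n` is blocked by `Z`: it has an inner node which is either a non-collider
in `Z`, or a collider such that neither it nor any of its descendants is in `Z`. -/
def IsBlocked (G : Digraph V) (Z : Set V) (n : ℕ) (π : ℕ → V) : Prop :=
  ∃ i, i + 1 < n ∧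
    ((¬ IsCollider G π i ∧ π (i + 1) ∈ Z) ∨
      (IsCollider G π i ∧ π (i + 1) ∉ Z ∧ Disjoint (descendants G (π (i + 1))) Z))

/-- `Z` d-separates `A` and `B` in `G`. -/
def DSep (G : Digraph V) (A B Z : Set V) : Prop :=
  ∀ n π, IsPath G n π → π 0 ∈ A → π n ∈ B → IsBlocked G Z n π

variable [Fintype V] {dim : V → ℕ}

/-- The causal Markov assumption: every variable is independent of its non-descendants given its
parents. -/
def CausalMarkov (G : Digraph V) (p : Config dim → ℝ) : Prop :=
  ∀ v, CondIndep p {v} {u | u ≠ v ∧ u ∉ descendants G v ∧ u ∉ parents G v} (parents G v)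

/-- Faithfulness: every conditional independence of the distribution is one that the graph
entails, that is, a d-separation. -/
def Faithful (G : Digraph V) (p : Config dim → ℝ) : Prop :=
  ∀ A B Z : Set V, Disjoint A B → Disjoint A Z → Disjoint B Z →
    CondIndep p A B Z → DSep G A B Z

/-- The column `ℙ(V_x = · | Pa_x = c)` of the conditional probability table of `x`. -/
def condColumn (G : Digraph V) (p : Config dim → ℝ) (x : V)
    (c : ∀ u : parents G x, Fin (dim u)) : Fin (dim x) → ℝ := fun a =>
  prob p (fun v => v x = a ∧ ∀ u : parents G x, v u = c u) /
    prob p (fun v => ∀ u : parents G x, v u = c u)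

end Graph

/-! ### Discrete latent structure models

The variables are `Lat ⊕ Obs`: `Sum.inl l` is the latent variable `l` and `Sum.inr x` the observed
variable `x`. -/

section Model

variable {Lat Obs : Type*}

/-- The observed variable `x` is a pure child of the latent variable `l`: the edge `l → x` is the
only edge of `G` at `x`. -/
def IsPureChild (G : Digraph (Lat ⊕ Obs)) (x : Obs) (l : Lat) : Prop :=
  (∀ u, G.Adj u (Sum.inr x) ↔ u = Sum.inl l) ∧ ∀ u, ¬ G.Adj (Sum.inr x) u

variable [Fintype Lat] [Fintype Obs] {dim : Lat ⊕ Obs → ℕ}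

/-- The discrete latent structure model. -/
structure IsDiscreteLSM (G : Digraph (Lat ⊕ Obs)) (p : Config dim → ℝ) : Prop where
  acyclic : IsAcyclic G
  two_le_dim : ∀ v, 2 ≤ dim v
  isPMF : IsPMF p
  /-- Every value of every variable has positive probability. -/
  pos : ∀ v (a : Fin (dim v)), 0 < prob p (fun w => w v = a)
  /-- Every joint value of the latent variables has positive probability. -/
  pos_latent : ∀ s, 0 < marginal p (Set.range Sum.inl) s
  /-- Purity: there are no edges between observed variables. -/
  purity : ∀ x y : Obs, ¬ G.Adj (Sum.inr x) (Sum.inr y)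
  /-- Every latent variable has at least three pure children. -/
  three_pure : ∀ l : Lat, 3 ≤ {x : Obs | IsPureChild G x l}.ncard
  /-- Sufficient observation: observed supports are larger than latent supports. -/
  sufficient : ∀ (x : Obs) (l : Lat),
    (support p (Sum.inl l)).ncard < (support p (Sum.inr x)).ncard

/-- The full rank assumption: the columns of the conditional probability table of every observed
variable given its parents are linearly independent. -/
def FullRank (G : Digraph (Lat ⊕ Obs)) (p : Config dim → ℝ) : Prop :=
  ∀ x : Obs, LinearIndependent ℝ (condColumn G p (Sum.inr x))

/-- `S` is a child set of the latent set `Lp`: it consists of pure children of members of `Lp`,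
and every member of `Lp` has a child in it. -/
def IsChildSet (G : Digraph (Lat ⊕ Obs)) (S : Finset Obs) (Lp : Finset Lat) : Prop :=
  (∀ x ∈ S, ∃ l ∈ Lp, IsPureChild G x l) ∧ ∀ l ∈ Lp, ∃ x ∈ S, IsPureChild G x l

/-- The joint probability tensor of the observed variables in `S`, with one mode per variable. -/
def jointTensor (p : Config dim → ℝ) (S : Finset Obs)
    (t : ∀ x : S, Fin (dim (Sum.inr x.1))) : ℝ :=
  prob p (fun v => ∀ x : S, v (Sum.inr x.1) = t x)

end Model

/-- The rank of a tensor with modes indexed by `ι`: the least `r` such that it is a sum of `r`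
outer products of vectors. -/
def tensorRank {ι : Type*} [Fintype ι] {κ : ι → Type*} (T : (∀ i, κ i) → ℝ) : ℕ :=
  sInf {r | ∃ u : Fin r → ∀ i, κ i → ℝ, ∀ t, T t = ∑ s, ∏ i, u s i (t i)}

end

end DiscreteLatent

/-! Split the modes of the tensor into two halves, `Xi` with `Xp1` and `Xj` with `Xp2`. Full rank
makes every conditional probability table left invertible, so a decomposition of the tensor into `k`
outer products can be contracted mode by mode. This gives a sum of `k` products for a matrix `K`
whose rows are indexed by values of `Li` and `Lp` and whose columns by values of `Lj` and `Lp`. Each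
member of `Lp` is read once on either side, so `K` vanishes unless the two readings agree. Thus `K`
is block diagonal, with one block for each value of `Lp`, and that block is the joint distribution
of `Li` and `Lj` at this value.

All latent configurations have positive probability, so no block is zero and `k` is at least the
number of blocks (`prod_dim_le`). If `k` equals this number, every block has rank one
(`exchange_of_le`), which is conditional independence of `Li` and `Lj` given `Lp`
(`condIndep_of_decomposition`). Conversely, under that independence the observed modes are mutually
independent given `Lp`, and summing over the values of `Lp` is a decomposition of the required
length (`exists_decomposition`).

For d-separation, faithfulness gives one direction. The other is the global Markov property, derived
from the local one in `condIndep_of_dSep`: the distribution of an ancestral set is a product of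
kernels, and active trails sort the kernels into two groups that share only variables of `Z`. -/

namespace DiscreteLatent

noncomputable section

open Classical in
/-- The configuration that agrees with `s` on `S` and with `t` elsewhere. -/
def mix {V : Type*} {dim : V → ℕ} (S : Set V) (s t : Config dim) : Config dim := S.piecewise s t

open Classical in
/-- The number of configurations with prescribed values on `S`. -/
def agreeCount {V : Type*} [Fintype V] (dim : V → ℕ) (S : Set V) : ℝ :=
  ∏ u, if u ∈ S then (1 : ℝ) else dim u

/-- The conditional probability of `s u` given the values of `s` at the parents of `u`. -/
def kernel {V : Type*} [Fintype V] {dim : V → ℕ} (G : Digraph V) (p : Config dim → ℝ) (u : V)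
    (s : Config dim) : ℝ :=
  marginal p (insert u (parents G u)) s / marginal p (parents G u) s

/-! ### Marginals and conditional independence -/

section Marginal

variable {V : Type*} {dim : V → ℕ} {S T : Set V} {s t : Config dim}

lemma mix_of_mem {u : V} (h : u ∈ S) : mix S s t u = s u := by
  simp [mix, Set.piecewise, h]

lemma mix_of_notMem {u : V} (h : u ∉ S) : mix S s t u = t u := by
  simp [mix, Set.piecewise, h]

variable [Fintype V] {p : Config dim → ℝ}

open Classical in
lemma prob_eq_sum_ite (p : Config dim → ℝ) (E : Config dim → Prop) :
    prob p E = ∑ v, if E v then p v else 0 := by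
  simp [prob, Finset.sum_filter]

lemma prob_congr {E E' : Config dim → Prop} (h : ∀ v, E v ↔ E' v) : prob p E = prob p E' := by
  have : E = E' := funext fun v => propext (h v)
  rw [this]

open Classical in
lemma prob_mono (hp : IsPMF p) {E E' : Config dim → Prop} (h : ∀ v, E v → E' v) :
    prob p E ≤ prob p E' := by
  rw [prob_eq_sum_ite, prob_eq_sum_ite]
  refine Finset.sum_le_sum fun v _ => ?_
  by_cases hE : E v
  · simp [hE, h v hE]
  · simp only [hE, if_false]
    split_ifs
    exacts [hp.1 v, le_rfl]

lemma prob_nonneg (hp : IsPMF p) (E : Config dim → Prop) : 0 ≤ prob p E :=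
  Finset.sum_nonneg fun v _ => hp.1 v

lemma marginal_nonneg (hp : IsPMF p) (S : Set V) (s : Config dim) : 0 ≤ marginal p S s :=
  prob_nonneg hp _

lemma marginal_anti (hp : IsPMF p) (h : S ⊆ T) (s : Config dim) :
    marginal p T s ≤ marginal p S s :=
  prob_mono hp fun _ hv u hu => hv u (h hu)

lemma dependsOn_marginal (p : Config dim → ℝ) (S : Set V) : DependsOn (marginal p S) S := by
  intro s t h
  refine prob_congr fun v => forall₂_congr fun u hu => ?_
  rw [h u hu]

lemma dependsOn_kernel (G : Digraph V) (p : Config dim → ℝ) (u : V) :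
    DependsOn (kernel G p u) (insert u (parents G u)) := by
  intro s t h
  unfold kernel
  rw [dependsOn_marginal p _ h,
    dependsOn_marginal p (parents G u) fun i hi => h i (Set.mem_insert_of_mem _ hi)]

lemma marginal_mix_of_subset (h : T ⊆ S) (s t : Config dim) :
    marginal p T (mix S s t) = marginal p T s :=
  dependsOn_marginal p T fun _ hu => mix_of_mem (h hu)

lemma agreeCount_pos (hdim : ∀ v, 2 ≤ dim v) (S : Set V) : 0 < agreeCount dim S := by
  refine Finset.prod_pos fun u _ => ?_
  split_ifs
  · exact one_pos
  · exact_mod_cast lt_of_lt_of_le two_pos (hdim u)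

open Classical in
lemma sum_agree (S : Set V) (v : Config dim) :
    (∑ t : Config dim, if ∀ u ∈ S, v u = t u then (1 : ℝ) else 0) = agreeCount dim S := by
  have h : ∀ t : Config dim, (if ∀ u ∈ S, v u = t u then (1 : ℝ) else 0) =
      ∏ u, if u ∈ S → v u = t u then (1 : ℝ) else 0 := by
    intro t
    by_cases ht : ∀ u ∈ S, v u = t u
    · rw [if_pos ht, Finset.prod_eq_one]
      intro u _
      exact if_pos (ht u)
    · rw [if_neg ht]
      push Not at ht
      obtain ⟨u, hu, hne⟩ := ht
      exact (Finset.prod_eq_zero (Finset.mem_univ u) (if_neg fun h => hne (h hu))).symm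
  rw [Finset.sum_congr rfl fun t _ => h t,
    ← Fintype.piFinset_univ, ← Finset.prod_univ_sum (fun _ => Finset.univ)
      (fun u a => if u ∈ S → v u = a then (1 : ℝ) else 0)]
  refine Finset.prod_congr rfl fun u _ => ?_
  by_cases hu : u ∈ S <;> simp [hu]

-- Summing over full configurations avoids a type of partial ones. The price is the factor: each
-- choice of values on `T \ S` is hit once for every way to fill in the remaining coordinates.
open Classical in
lemma sum_marginal_mix (p : Config dim → ℝ) (h : S ⊆ T) (s : Config dim) :
    ∑ t, marginal p T (mix S s t) = agreeCount dim (T \ S) * marginal p S s := by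
  simp only [marginal, prob_eq_sum_ite]
  rw [Finset.sum_comm, Finset.mul_sum]
  refine Finset.sum_congr rfl fun v _ => ?_
  have key : ∀ t : Config dim, (∀ u ∈ T, v u = mix S s t u) ↔
      (∀ u ∈ S, v u = s u) ∧ ∀ u ∈ T \ S, v u = t u := by
    intro t
    constructor
    · refine fun H => ⟨fun u hu => ?_, fun u hu => ?_⟩
      · rw [H u (h hu), mix_of_mem hu]
      · rw [H u hu.1, mix_of_notMem hu.2]
    · rintro ⟨h1, h2⟩ u hu
      by_cases huS : u ∈ S
      · rw [mix_of_mem huS, h1 u huS]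
      · rw [mix_of_notMem huS, h2 u ⟨hu, huS⟩]
  rw [← sum_agree (T \ S) v, Finset.sum_mul]
  refine Finset.sum_congr rfl fun t _ => ?_
  simp only [key t]
  rw [ite_and, ite_mul, one_mul, zero_mul]
  split_ifs <;> rfl

open Classical in
/-- Marginalising over a finite type of exclusive and exhaustive events. -/
lemma prob_eq_sum_prob {ι : Type*} [Fintype ι] (X : Config dim → ι) (E : Config dim → Prop) :
    prob p E = ∑ i, prob p (fun v => E v ∧ X v = i) := by
  simp only [prob_eq_sum_ite]
  rw [Finset.sum_comm]
  refine Finset.sum_congr rfl fun v _ => ?_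
  by_cases hE : E v <;> simp [hE]

lemma CondIndep.symm {A B C : Set V} (h : CondIndep p A B C) : CondIndep p B A C := by
  intro s
  have := h s
  rw [Set.union_comm B A, this, mul_comm]

-- Sum the defining identity over the coordinates in `B` to be dropped. Disjointness of `A` and `B`
-- makes the same coordinates disappear on both sides, so the counting factors cancel.
open Classical in
lemma CondIndep.mono_right (hdim : ∀ v, 2 ≤ dim v) {A B B' C : Set V} (h : CondIndep p A B C)
    (hB : B' ⊆ B) (hAB : Disjoint A B) : CondIndep p A B' C := by
  intro s
  have hsub : A ∪ B' ∪ C ⊆ A ∪ B ∪ C :=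
    Set.union_subset_union_left _ (Set.union_subset_union_right _ hB)
  have hsub' : B' ∪ C ⊆ B ∪ C := Set.union_subset_union_left _ hB
  have h1 := sum_marginal_mix p hsub s
  have h2 := sum_marginal_mix p hsub' s
  have hcnt : (A ∪ B ∪ C) \ (A ∪ B' ∪ C) = (B ∪ C) \ (B' ∪ C) := by
    ext u
    have : u ∈ A → u ∉ B := fun h => Set.disjoint_left.mp hAB h
    simp only [Set.mem_sdiff, Set.mem_union]
    tauto
  have h3 : ∀ t, marginal p (B ∪ C) (mix (A ∪ B' ∪ C) s t) =
      marginal p (B ∪ C) (mix (B' ∪ C) s t) := by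
    intro t
    refine dependsOn_marginal p _ fun u hu => ?_
    by_cases hu' : u ∈ B' ∪ C
    · rw [mix_of_mem hu', mix_of_mem (by simp only [Set.mem_union] at hu' ⊢; tauto)]
    · rw [mix_of_notMem hu', mix_of_notMem]
      have : u ∈ A → u ∉ B := fun h => Set.disjoint_left.mp hAB h
      simp only [Set.mem_union] at hu hu' ⊢
      tauto
  have hpos := agreeCount_pos hdim ((B ∪ C) \ (B' ∪ C))
  rw [hcnt] at h1
  refine mul_left_cancel₀ hpos.ne' ?_
  calc _ = (∑ t, marginal p (A ∪ B ∪ C) (mix (A ∪ B' ∪ C) s t)) * marginal p C s := by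
        rw [h1, mul_assoc]
    _ = ∑ t, marginal p (A ∪ C) s * marginal p (B ∪ C) (mix (B' ∪ C) s t) := by
        rw [Finset.sum_mul]
        refine Finset.sum_congr rfl fun t _ => ?_
        have := h (mix (A ∪ B' ∪ C) s t)
        rwa [h3, marginal_mix_of_subset (T := C) Set.subset_union_right,
          marginal_mix_of_subset (T := A ∪ C)
            (Set.union_subset_union_left _ Set.subset_union_left)] at this
    _ = _ := by rw [← Finset.mul_sum, h2]; ring

lemma CondIndep.mono (hdim : ∀ v, 2 ≤ dim v) {A A' B B' C : Set V} (h : CondIndep p A B C)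
    (hA : A' ⊆ A) (hB : B' ⊆ B) (hAB : Disjoint A B) : CondIndep p A' B' C :=
  ((h.mono_right hdim hB hAB).symm.mono_right hdim hA (hAB.mono_right hB).symm).symm

open Classical in
/-- The factorization criterion for conditional independence. -/
lemma condIndep_of_factor (hdim : ∀ v, 2 ≤ dim v) {A B C : Set V} (hAB : Disjoint A B)
    (hAC : Disjoint A C) (hBC : Disjoint B C) {F H : Config dim → ℝ}
    (hF : DependsOn F (A ∪ C)) (hH : DependsOn H (B ∪ C))
    (h : ∀ s, marginal p (A ∪ B ∪ C) s = F s * H s) : CondIndep p A B C := by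
  intro s
  have dAB : ∀ u, u ∈ A → u ∉ B := fun u h => Set.disjoint_left.mp hAB h
  have dAC : ∀ u, u ∈ A → u ∉ C := fun u h => Set.disjoint_left.mp hAC h
  have dBC : ∀ u, u ∈ B → u ∉ C := fun u h => Set.disjoint_left.mp hBC h
  -- With everything outside `C` summed out, `f` and `g` depend on `C` alone. Up to counting
  -- factors, the marginals on `A ∪ C`, `B ∪ C` and `C` are then `F * g`, `H * f` and `f * g`.
  set f : Config dim → ℝ := fun s => ∑ t, F (mix C s t) with hf
  set g : Config dim → ℝ := fun s => ∑ t, H (mix C s t) with hg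
  have eB : (A ∪ B ∪ C) \ (A ∪ C) = B := by
    ext u
    have := dAB u; have := dBC u
    simp only [Set.mem_sdiff, Set.mem_union]; tauto
  have eA : (A ∪ B ∪ C) \ (B ∪ C) = A := by
    ext u
    have := dAB u; have := dAC u
    simp only [Set.mem_sdiff, Set.mem_union]; tauto
  have eA' : (A ∪ C) \ C = A := by
    ext u
    have := dAC u
    simp only [Set.mem_sdiff, Set.mem_union]; tauto
  have h1 : ∀ s, agreeCount dim B * marginal p (A ∪ C) s = F s * g s := by
    intro s
    have := sum_marginal_mix p
      (show A ∪ C ⊆ A ∪ B ∪ C from Set.union_subset_union_left _ Set.subset_union_left) s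
    rw [eB] at this
    rw [← this, hg, Finset.mul_sum]
    refine Finset.sum_congr rfl fun t _ => ?_
    rw [h, hF fun u hu => mix_of_mem hu]
    congr 1
    refine hH fun u hu => ?_
    by_cases hu' : u ∈ C
    · rw [mix_of_mem hu', mix_of_mem (Set.mem_union_right _ hu')]
    · rw [mix_of_notMem hu', mix_of_notMem]
      have := dAB u
      simp only [Set.mem_union] at hu ⊢; tauto
  have h2 : agreeCount dim A * marginal p (B ∪ C) s = H s * f s := by
    have := sum_marginal_mix p
      (show B ∪ C ⊆ A ∪ B ∪ C from Set.union_subset_union_left _ Set.subset_union_right) s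
    rw [eA] at this
    rw [← this, hf, Finset.mul_sum]
    refine Finset.sum_congr rfl fun t _ => ?_
    rw [h, hH fun u hu => mix_of_mem hu, mul_comm]
    congr 1
    refine hF fun u hu => ?_
    by_cases hu' : u ∈ C
    · rw [mix_of_mem hu', mix_of_mem (Set.mem_union_right _ hu')]
    · rw [mix_of_notMem hu', mix_of_notMem]
      have := dAB u
      simp only [Set.mem_union] at hu ⊢; tauto
  have h3 : agreeCount dim B * (agreeCount dim A * marginal p C s) = f s * g s := by
    have := sum_marginal_mix p (show C ⊆ A ∪ C from Set.subset_union_right) s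
    rw [eA'] at this
    rw [← this, Finset.mul_sum, hf, Finset.sum_mul]
    refine Finset.sum_congr rfl fun t _ => ?_
    rw [h1]
    congr 1
    refine Finset.sum_congr rfl fun t' _ => hH fun u hu => ?_
    by_cases hu' : u ∈ C
    · rw [mix_of_mem hu', mix_of_mem hu', mix_of_mem hu']
    · rw [mix_of_notMem hu', mix_of_notMem hu']
  have pA := agreeCount_pos hdim A
  have pB := agreeCount_pos hdim B
  refine mul_left_cancel₀ (mul_pos pA pB).ne' ?_
  rw [h]
  linear_combination (F s * H s) * h3 - agreeCount dim A * marginal p (B ∪ C) s * h1 s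
    - F s * g s * h2

end Marginal

/-! ### Splitting off a variable by the local Markov property -/

section Markov

variable {V : Type*} [Fintype V] {dim : V → ℕ} {G : Digraph V} {p : Config dim → ℝ}

/-- A variable can be split off from a set that contains its parents and none of its
descendants. -/
lemma marginal_insert (hdim : ∀ v, 2 ≤ dim v) (hp : IsPMF p) (hM : CausalMarkov G p) {u : V}
    {S : Set V} (hu : u ∉ S) (hpa : parents G u ⊆ S) (hde : Disjoint S (descendants G u))
    (s : Config dim) : marginal p (insert u S) s = kernel G p u s * marginal p S s := by
  have hCI : CondIndep p {u} (S \ parents G u) (parents G u) := by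
    refine (hM u).mono_right hdim (fun x hx => ⟨?_, ?_, hx.2⟩) ?_
    · rintro rfl; exact hu hx.1
    · exact Set.disjoint_left.mp hde hx.1
    · simp
  have h := hCI s
  rw [Set.union_assoc, Set.sdiff_union_of_subset hpa, Set.singleton_union, Set.singleton_union] at h
  -- When the parents' values have probability zero, the kernel is a division by zero, but both
  -- sides vanish.
  by_cases h0 : marginal p (parents G u) s = 0
  · have h1 : marginal p (insert u S) s = 0 :=
      le_antisymm (h0 ▸ marginal_anti hp (hpa.trans (Set.subset_insert _ _)) s)
        (marginal_nonneg hp _ _)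
    rw [h1, kernel, h0]; simp
  · rw [kernel, div_mul_eq_mul_div, eq_div_iff h0, h]

end Markov

/-! ### Active trails and soundness of d-separation -/

section GlobalMarkov

variable {V : Type*} {G : Digraph V}

/-- Active trails from `a` given `Z`; the flag tells whether the last edge points into the last
node. -/
inductive Trail (G : Digraph V) (Z : Set V) (a : V) : V → Bool → Prop
  | start : Trail G Z a a false
  | down {x y : V} {k : Bool} : Trail G Z a x k → x ∉ Z → G.Adj x y → Trail G Z a y true
  | up {x y : V} : Trail G Z a x false → x ∉ Z → G.Adj y x → Trail G Z a y false
  | turn {x y : V} : Trail G Z a x true → (x ∈ Z ∨ ¬ Disjoint (descendants G x) Z) → G.Adj y x →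
      Trail G Z a y false

/-- Appending `y` creates at most one new inner node, `π n`. For `n = 0` there is none, and the
hypothesis is vacuous. -/
lemma not_isBlocked_extend {Z : Set V} {n : ℕ} {π : ℕ → V} {y : V} (hb : ¬ IsBlocked G Z n π)
    (h : ∀ i, i + 1 = n → (G.Adj (π i) (π n) ∧ G.Adj y (π n) ∧
      (π n ∈ Z ∨ ¬ Disjoint (descendants G (π n)) Z)) ∨
      (¬ (G.Adj (π i) (π n) ∧ G.Adj y (π n)) ∧ π n ∉ Z)) :
    ¬ IsBlocked G Z (n + 1) (fun i => if i ≤ n then π i else y) := by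
  rintro ⟨i, hi, hbl⟩
  have e0 : i ≤ n := by omega
  have e1 : i + 1 ≤ n := by omega
  simp only [IsCollider, e0, e1, if_true] at hbl
  by_cases e2 : i + 2 ≤ n
  · simp only [e2, if_true] at hbl
    exact hb ⟨i, by omega, hbl⟩
  · obtain rfl : i + 1 = n := by omega
    simp only [e2, if_false] at hbl
    rcases h i rfl with h | h <;> tauto

lemma isPath_extend {n : ℕ} {π : ℕ → V} {y : V} (hp : IsPath G n π)
    (h : G.Adj (π n) y ∨ G.Adj y (π n)) :
    IsPath G (n + 1) (fun i => if i ≤ n then π i else y) := by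
  intro i hi
  have e0 : i ≤ n := by omega
  by_cases e1 : i + 1 ≤ n
  · simpa only [e0, e1, if_true] using hp i (by omega)
  · obtain rfl : i = n := by omega
    simpa only [le_refl, e1, if_true, if_false] using h

lemma IsAcyclic.not_adj_symm (hG : IsAcyclic G) {x y : V} (h : G.Adj x y) : ¬ G.Adj y x :=
  fun h' => hG x ((Relation.TransGen.single h).tail h')

/-- Paths in the sense of `IsPath` may revisit nodes, so a trail is a path as it stands. Acyclicity
excludes opposite edges between two nodes, so the flag decides whether the last node becomes a
collider. -/
lemma Trail.exists_path (hG : IsAcyclic G) {Z : Set V} {a x : V} {k : Bool}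
    (h : Trail G Z a x k) : ∃ n π, IsPath G n π ∧ π 0 = a ∧ π n = x ∧ ¬ IsBlocked G Z n π ∧
      ∀ i, i + 1 = n → if k then G.Adj (π i) x else G.Adj x (π i) := by
  have aux : ∀ {x y : V} {k : Bool} {n : ℕ} {π : ℕ → V} (k' : Bool), IsPath G n π → π 0 = a →
      π n = x → ¬ IsBlocked G Z n π →
      (∀ i, i + 1 = n → if k then G.Adj (π i) x else G.Adj x (π i)) →
      (if k' then G.Adj x y else G.Adj y x) →
      ((k' = true ∨ k = false) ∧ x ∉ Z ∨
        (k' = false ∧ k = true ∧ (x ∈ Z ∨ ¬ Disjoint (descendants G x) Z))) →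
      ∃ n π, IsPath G n π ∧ π 0 = a ∧ π n = y ∧ ¬ IsBlocked G Z n π ∧
        ∀ i, i + 1 = n → if k' then G.Adj (π i) y else G.Adj y (π i) := by
    intro x y k n π k' hp h0 hn hb hl he hc
    subst hn
    refine ⟨n + 1, fun i => if i ≤ n then π i else y, isPath_extend hp ?_, by simpa using h0,
      by simp, not_isBlocked_extend hb ?_, ?_⟩
    · cases k'
      · exact Or.inr he
      · exact Or.inl he
    · intro i hi
      have hl := hl i hi
      -- Only the third case, in by an arrow into `x` and out against an arrow into `x`, is a
      -- collider.
      cases k <;> cases k' <;> simp at hl he hc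
      · exact Or.inr ⟨fun h => hG.not_adj_symm hl h.1, hc⟩
      · exact Or.inr ⟨fun h => hG.not_adj_symm he h.2, hc⟩
      · exact Or.inl ⟨hl, he, hc⟩
      · exact Or.inr ⟨fun h => hG.not_adj_symm he h.2, hc⟩
    · intro i hi
      obtain rfl : i = n := by omega
      simpa using he
  induction h with
  | start =>
    refine ⟨0, fun _ => a, fun i hi => absurd hi (by omega), rfl, rfl, ?_, fun i hi => by omega⟩
    rintro ⟨i, hi, -⟩
    omega
  | down _ hx hxy ih =>
    obtain ⟨n, π, h1, h2, h3, h4, h5⟩ := ih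
    exact aux true h1 h2 h3 h4 h5 hxy (Or.inl ⟨Or.inl rfl, hx⟩)
  | up _ hx hxy ih =>
    obtain ⟨n, π, h1, h2, h3, h4, h5⟩ := ih
    exact aux false h1 h2 h3 h4 h5 hxy (Or.inl ⟨Or.inr rfl, hx⟩)
  | turn _ hx hxy ih =>
    obtain ⟨n, π, h1, h2, h3, h4, h5⟩ := ih
    exact aux false h1 h2 h3 h4 h5 hxy (Or.inr ⟨rfl, rfl, hx⟩)

lemma not_trail_of_dSep (hG : IsAcyclic G) {Z : Set V} {a b : V} (h : DSep G {a} {b} Z)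
    (k : Bool) : ¬ Trail G Z a b k := by
  intro ht
  obtain ⟨n, π, h1, h2, h3, h4, -⟩ := ht.exists_path hG
  exact h4 (h n π h1 h2 h3)

/-- The nodes from which a directed path, possibly of length zero, leads to `S`. -/
def ancestors (G : Digraph V) (S : Set V) : Set V := {v | ∃ w ∈ S, Relation.ReflTransGen G.Adj v w}

lemma subset_ancestors (S : Set V) : S ⊆ ancestors G S := fun v hv => ⟨v, hv, .refl⟩

lemma parents_subset_ancestors {S : Set V} {u : V} (hu : u ∈ ancestors G S) :
    parents G u ⊆ ancestors G S := by
  obtain ⟨w, hw, h⟩ := hu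
  exact fun v hv => ⟨w, hw, h.head hv⟩

lemma not_disjoint_descendants {Z : Set V} {u : V} (hu : u ∈ ancestors G Z) :
    u ∈ Z ∨ ¬ Disjoint (descendants G u) Z := by
  obtain ⟨w, hw, h⟩ := hu
  rcases Relation.reflTransGen_iff_eq_or_transGen.mp h with rfl | h
  · exact Or.inl hw
  · exact Or.inr (Set.not_disjoint_iff.mpr ⟨w, h, hw⟩)

lemma Trail.exists_of_reflTransGen {Z : Set V} {a u b : V} {k : Bool}
    (h : Relation.ReflTransGen G.Adj u b) (hu : u ∉ ancestors G Z) (ht : Trail G Z a u k) :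
    ∃ k, Trail G Z a b k := by
  induction h with
  | refl => exact ⟨k, ht⟩
  | tail h1 h2 ih =>
    obtain ⟨k, ih⟩ := ih
    exact ⟨true, ih.down (fun hZ => hu ⟨_, hZ, h1⟩) h2⟩

lemma Trail.of_reflTransGen {Z : Set V} {a u : V} (h : Relation.ReflTransGen G.Adj u a)
    (hu : u ∉ ancestors G Z) : Trail G Z a u false := by
  induction h using Relation.ReflTransGen.head_induction_on with
  | refl => exact .start
  | head h1 h2 ih =>
    have hc := fun hc : _ ∈ ancestors G Z => hu (parents_subset_ancestors hc h1)
    exact (ih hc).up (fun hZ => hc (subset_ancestors _ hZ)) h1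

/-- The only obstacle is a collider at `u`. It is open if `u` is an ancestor of `Z`. If not, and `u`
is an ancestor of `a`, climbing from `a` reaches `u` without a collider there. If `u` is an ancestor
of `b`, the trail would run down to `b`, which is excluded. -/
lemma Trail.to_parent {Z : Set V} {a b u y : V} {k : Bool} (hab : ∀ k, ¬ Trail G Z a b k)
    (hu : u ∈ ancestors G (insert a (insert b Z))) (ht : Trail G Z a u k)
    (hk : k = false → u ∉ Z) (hy : G.Adj y u) : Trail G Z a y false := by
  cases k
  · exact ht.up (hk rfl) hy
  · by_cases huZ : u ∈ ancestors G Z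
    · exact ht.turn (not_disjoint_descendants huZ) hy
    · obtain ⟨w, hw, h⟩ := hu
      rcases hw with rfl | rfl | hw
      · exact (Trail.of_reflTransGen h huZ).up (fun hZ => huZ (subset_ancestors _ hZ)) hy
      · obtain ⟨k, hk⟩ := Trail.exists_of_reflTransGen h huZ ht
        exact absurd hk (hab k)
      · exact absurd ⟨w, hw, h⟩ huZ

/-- The variables of one kernel are a node and its parents. Reaching one of them outside `Z` means
reaching all, so no kernel mixes reached and unreached variables outside `Z`. This replaces the
passage to the moral graph. -/
lemma Trail.to_family {Z : Set V} {a b u x y : V} {k : Bool} (hab : ∀ k, ¬ Trail G Z a b k)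
    (hu : u ∈ ancestors G (insert a (insert b Z))) (ht : Trail G Z a x k) (hxZ : x ∉ Z)
    (hx : x ∈ insert u (parents G u)) (hy : y ∈ insert u (parents G u)) :
    ∃ k, Trail G Z a y k := by
  rcases hx with rfl | hx
  · rcases hy with rfl | hy
    · exact ⟨k, ht⟩
    · exact ⟨false, ht.to_parent hab hu (fun _ => hxZ) hy⟩
  · have htu := ht.down hxZ hx
    rcases hy with rfl | hy
    · exact ⟨true, htu⟩
    · exact ⟨false, htu.to_parent hab hu (by simp) hy⟩

variable [Fintype V] {dim : V → ℕ} {p : Config dim → ℝ}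

lemma marginal_empty (hp : IsPMF p) (s : Config dim) : marginal p ∅ s = 1 := by
  rw [← hp.2]
  exact prob_congr fun v => by simp

open Classical in
lemma exists_sink (hG : IsAcyclic G) {W : Finset V} (hW : W.Nonempty) :
    ∃ u ∈ W, ∀ w ∈ W, ¬ Relation.TransGen G.Adj u w := by
  let r : V → V → Prop := fun x y => Relation.TransGen G.Adj y x
  have : IsTrans V r := ⟨fun _ _ _ h1 h2 => h2.trans h1⟩
  have : Std.Irrefl r := ⟨fun x => hG x⟩
  obtain ⟨u, hu, h⟩ := (Finite.wellFounded_of_trans_of_irrefl r).has_min (W : Set V) hW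
  exact ⟨u, hu, h⟩

open Classical in
/-- The distribution of an ancestral set is the product of the kernels of its members. -/
lemma marginal_eq_prod_kernel (hdim : ∀ v, 2 ≤ dim v) (hG : IsAcyclic G) (hp : IsPMF p)
    (hM : CausalMarkov G p) (W : Finset V) (hW : ∀ u ∈ W, parents G u ⊆ W) (s : Config dim) :
    marginal p (W : Set V) s = ∏ u ∈ W, kernel G p u s := by
  induction W using Finset.strongInduction with
  | H W ih =>
    rcases W.eq_empty_or_nonempty with rfl | hne
    · simpa using marginal_empty hp s
    · obtain ⟨u, huW, hu⟩ := exists_sink hG hne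
      have hpar : ∀ w ∈ W, parents G w ⊆ ((W.erase u : Finset V) : Set V) := by
        intro w hw x hx
        rw [Finset.mem_coe, Finset.mem_erase]
        refine ⟨?_, hW w hw hx⟩
        rintro rfl
        exact hu w hw (.single hx)
      have e : (W : Set V) = insert u ((W.erase u : Finset V) : Set V) := by
        rw [← Finset.coe_insert, Finset.insert_erase huW]
      rw [← Finset.mul_prod_erase W _ huW, e, marginal_insert hdim hp hM (by simp) (hpar u huW)
        (Set.disjoint_left.mpr fun x hx hx' => hu x (Finset.mem_of_mem_erase hx) hx'),
        ih _ (Finset.erase_ssubset huW) fun w hw => hpar w (Finset.mem_of_mem_erase hw)]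

open Classical in
/-- Soundness of d-separation. -/
theorem condIndep_of_dSep (hdim : ∀ v, 2 ≤ dim v) (hG : IsAcyclic G) (hp : IsPMF p)
    (hM : CausalMarkov G p) {a b : V} {Z : Set V} (ha : a ∉ Z) (hb : b ∉ Z)
    (h : DSep G {a} {b} Z) : CondIndep p {a} {b} Z := by
  have hab := not_trail_of_dSep hG h
  set W := ancestors G (insert a (insert b Z)) with hWdef
  have hSW : insert a (insert b Z) ⊆ W := subset_ancestors _
  have hZW : Z ⊆ W := fun z hz => hSW (by simp [hz])
  set A : Set V := {x | x ∈ W ∧ x ∉ Z ∧ ∃ k, Trail G Z a x k} with hA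
  set B : Set V := {x | x ∈ W ∧ x ∉ Z ∧ ¬ ∃ k, Trail G Z a x k} with hB
  have hAB : Disjoint A B := Set.disjoint_left.mpr fun x h1 h2 => h2.2.2 h1.2.2
  have hW : A ∪ B ∪ Z = W := by
    ext x
    have := @hZW x
    simp only [hA, hB, Set.mem_union, Set.mem_ofPred_eq]
    tauto
  have hWc : (A ∪ B ∪ Z) = (W.toFinset : Set V) := by rw [hW, Set.coe_toFinset]
  -- Kernels involving a reached variable form `F`, the others `H`.
  let P : V → Prop := fun u => ∃ x ∈ insert u (parents G u), x ∈ A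
  have hfam : ∀ u ∈ W, insert u (parents G u) ⊆ W := fun u hu =>
    Set.insert_subset hu (parents_subset_ancestors hu)
  refine CondIndep.mono hdim (A := A) (B := B) ?_ ?_ ?_ hAB
  · refine condIndep_of_factor hdim hAB (Set.disjoint_left.mpr fun x hx => hx.2.1)
      (Set.disjoint_left.mpr fun x hx => hx.2.1)
      (F := fun s => ∏ u ∈ W.toFinset with P u, kernel G p u s)
      (H := fun s => ∏ u ∈ W.toFinset with ¬ P u, kernel G p u s) ?_ ?_ ?_
    · intro s t hst
      refine Finset.prod_congr rfl fun u hu => dependsOn_kernel G p u fun y hy => hst y ?_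
      rw [Finset.mem_filter, Set.mem_toFinset] at hu
      obtain ⟨huW, x, hx, hxA⟩ := hu
      obtain ⟨k, hk⟩ := hxA.2.2
      by_cases hyZ : y ∈ Z
      · exact Or.inr hyZ
      · exact Or.inl ⟨hfam u huW hy, hyZ, hk.to_family hab huW hxA.2.1 hx hy⟩
    · intro s t hst
      refine Finset.prod_congr rfl fun u hu => dependsOn_kernel G p u fun y hy => hst y ?_
      rw [Finset.mem_filter, Set.mem_toFinset] at hu
      obtain ⟨huW, hx⟩ := hu
      by_cases hyZ : y ∈ Z
      · exact Or.inr hyZ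
      · exact Or.inl ⟨hfam u huW hy, hyZ, fun hk => hx ⟨y, hy, hfam u huW hy, hyZ, hk⟩⟩
    · intro s
      rw [hWc, marginal_eq_prod_kernel hdim hG hp hM _ (fun u hu => ?_),
        Finset.prod_filter_mul_prod_filter_not]
      rw [Set.mem_toFinset] at hu
      rw [Set.coe_toFinset]
      exact parents_subset_ancestors hu
  · exact Set.singleton_subset_iff.mpr ⟨hSW (by simp), ha, false, .start⟩
  · exact Set.singleton_subset_iff.mpr ⟨hSW (by simp), hb, fun ⟨k, hk⟩ => hab k hk⟩

end GlobalMarkov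

/-! ### Independent rows and dual vectors -/

section LinearAlgebra

/-- Row `v` of `K` is a linear image of the vector `f · v` of length `k`, so independent rows come
from independent vectors in a space of dimension `k`. -/
lemma card_le_of_independent_rows {I X : Type*} [Fintype I] {k : ℕ} {K : X → X → ℝ}
    {f h : Fin k → X → ℝ} (hK : ∀ v w, K v w = ∑ s, f s v * h s w) (e : I → X)
    (hind : ∀ c : I → ℝ, (∀ w, ∑ i, c i * K (e i) w = 0) → ∀ i, c i = 0) :
    Fintype.card I ≤ k := by
  have hli : LinearIndependent ℝ (fun i s => f s (e i) : I → Fin k → ℝ) := by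
    rw [Fintype.linearIndependent_iff]
    intro c hc
    refine hind c fun w => ?_
    have hc' : ∀ s, ∑ i, c i * f s (e i) = 0 := fun s => by
      simpa using congrFun hc s
    calc ∑ i, c i * K (e i) w = ∑ s, (∑ i, c i * f s (e i)) * h s w := by
          simp only [hK, Finset.mul_sum, Finset.sum_mul]
          rw [Finset.sum_comm]
          simp only [mul_assoc]
      _ = 0 := by simp [hc']
  simpa using hli.fintype_card_le_finrank

-- The `D c'` are the rows of a left inverse of the matrix with columns `f c`; contracting a mode
-- with them undoes a conditional probability table.
open Classical in
lemma exists_dual_of_linearIndependent {ι κ : Type*} [Fintype κ] {f : ι → κ → ℝ}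
    (hf : LinearIndependent ℝ f) :
    ∃ D : ι → κ → ℝ, ∀ c c', ∑ a, f c a * D c' a = if c = c' then 1 else 0 := by
  obtain ⟨g, hg⟩ := LinearMap.exists_leftInverse_of_injective (Finsupp.linearCombination ℝ f)
    (LinearMap.ker_eq_bot.mpr hf)
  refine ⟨fun c a => g (Pi.single a 1) c, fun c c' => ?_⟩
  have h1 : g (f c) = Finsupp.single c 1 := by
    have := LinearMap.congr_fun hg (Finsupp.single c 1)
    simpa using this
  have h2 : f c = ∑ a, f c a • (Pi.single a 1 : κ → ℝ) := by
    ext a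
    simp [Finset.sum_apply, Pi.single_apply]
  calc ∑ a, f c a * g (Pi.single a 1) c' = g (∑ a, f c a • (Pi.single a 1 : κ → ℝ)) c' := by
        rw [map_sum, Finsupp.finsetSum_apply]
        simp
    _ = _ := by rw [← h2, h1, Finsupp.single_apply]

end LinearAlgebra

/-! ### The joint tensor as a mixture over the parents -/

section Tensor

variable {Lat Obs : Type*} {dim : Lat ⊕ Obs → ℕ}

open Classical in
/-- The configuration with values `t` on the observed variables in `S`, and those of `v`
elsewhere. -/
def withObs {S : Finset Obs} (t : ∀ x : S, Fin (dim (Sum.inr x.1))) (v : Config dim) :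
    Config dim
  | Sum.inl l => v (Sum.inl l)
  | Sum.inr x => if h : x ∈ S then t ⟨x, h⟩ else v (Sum.inr x)

@[simp]
lemma withObs_inl {S : Finset Obs} (t : ∀ x : S, Fin (dim (Sum.inr x.1))) (v : Config dim)
    (l : Lat) : withObs t v (Sum.inl l) = v (Sum.inl l) := rfl

lemma withObs_inr {S : Finset Obs} (t : ∀ x : S, Fin (dim (Sum.inr x.1))) (v : Config dim)
    (x : S) : withObs t v (Sum.inr x.1) = t x := by
  simp [withObs]

variable [Fintype Lat] [Fintype Obs] {G : Digraph (Lat ⊕ Obs)} {p : Config dim → ℝ}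

lemma kernel_eq_condColumn (G : Digraph (Lat ⊕ Obs)) (p : Config dim → ℝ) (u : Lat ⊕ Obs)
    (s : Config dim) : kernel G p u s = condColumn G p u (fun w => s w) (s u) := by
  unfold kernel condColumn marginal
  congr 1 <;> refine prob_congr fun v => ?_ <;> simp

lemma jointTensor_eq_marginal (p : Config dim → ℝ) {S : Finset Obs}
    (t : ∀ x : S, Fin (dim (Sum.inr x.1))) (v : Config dim) :
    jointTensor p S t = marginal p (Sum.inr '' (S : Set Obs)) (withObs t v) := by
  refine prob_congr fun w => ⟨?_, fun h x => ?_⟩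
  · rintro h _ ⟨x, hx, rfl⟩
    rw [withObs_inr t v ⟨x, hx⟩]
    exact h ⟨x, hx⟩
  · rw [← withObs_inr t v x]
    exact h _ ⟨x.1, x.2, rfl⟩

/-- The members of `S` are childless with parents in `U`, and `U` contains none of them. -/
structure IsLeafSet (G : Digraph (Lat ⊕ Obs)) (S : Finset Obs) (U : Set (Lat ⊕ Obs)) : Prop where
  notMem : ∀ x ∈ S, Sum.inr x ∉ U
  parents_subset : ∀ x ∈ S, parents G (Sum.inr x) ⊆ U
  not_adj : ∀ x ∈ S, ∀ u, ¬ G.Adj (Sum.inr x) u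

open Classical in
lemma marginal_union_leaves (hdim : ∀ v, 2 ≤ dim v) (hp : IsPMF p) (hM : CausalMarkov G p)
    {S : Finset Obs} {U : Set (Lat ⊕ Obs)} (h : IsLeafSet G S U) (s : Config dim) :
    marginal p (U ∪ Sum.inr '' (S : Set Obs)) s =
      marginal p U s * ∏ x ∈ S, kernel G p (Sum.inr x) s := by
  induction S using Finset.induction_on with
  | empty => simp
  | insert x S hx ih =>
    have hS : IsLeafSet G S U := ⟨fun y hy => h.notMem y (Finset.mem_insert_of_mem hy),
      fun y hy => h.parents_subset y (Finset.mem_insert_of_mem hy),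
      fun y hy => h.not_adj y (Finset.mem_insert_of_mem hy)⟩
    have hxS := Finset.mem_insert_self x S
    rw [Finset.prod_insert hx, Finset.coe_insert, Set.image_insert_eq, Set.union_insert,
      marginal_insert hdim hp hM, ih hS]
    · ring
    · rintro (hU | ⟨y, hy, hyx⟩)
      · exact h.notMem x hxS hU
      · exact hx (Sum.inr_injective hyx ▸ hy)
    · exact (h.parents_subset x hxS).trans Set.subset_union_left
    · refine Set.disjoint_left.mpr fun w _ hw => ?_
      obtain ⟨u, hu, -⟩ := Relation.TransGen.head'_iff.mp hw
      exact h.not_adj x hxS u hu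

-- Given `U` the members of `S` are independent, each following its column; `U` is then summed out.
open Classical in
lemma agreeCount_mul_jointTensor (hdim : ∀ v, 2 ≤ dim v) (hp : IsPMF p) (hM : CausalMarkov G p)
    {S : Finset Obs} {U : Set (Lat ⊕ Obs)} (h : IsLeafSet G S U)
    (t : ∀ x : S, Fin (dim (Sum.inr x.1))) :
    agreeCount dim U * jointTensor p S t =
      ∑ v : Config dim, marginal p U v *
        ∏ x : S, condColumn G p (Sum.inr x.1) (fun u => v u) (t x) := by
  let s : Config dim := withObs t fun v => ⟨0, by have := hdim v; omega⟩
  have e : (U ∪ Sum.inr '' (S : Set Obs)) \ Sum.inr '' (S : Set Obs) = U := by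
    refine Set.union_sdiff_cancel_right ?_
    rintro _ ⟨hU, x, hx, rfl⟩
    exact h.notMem x hx hU
  have hs := sum_marginal_mix p
    (show Sum.inr '' (S : Set Obs) ⊆ U ∪ Sum.inr '' (S : Set Obs) from Set.subset_union_right) s
  rw [e, ← jointTensor_eq_marginal] at hs
  rw [← hs]
  refine Finset.sum_congr (by ext; simp) fun v _ => ?_
  have hagree : ∀ u ∈ U, mix (Sum.inr '' (S : Set Obs)) s v u = v u := by
    intro u hu
    refine mix_of_notMem ?_
    rintro ⟨x, hx, rfl⟩
    exact h.notMem x hx hu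
  rw [marginal_union_leaves hdim hp hM h, dependsOn_marginal p U hagree, ← Finset.prod_coe_sort]
  congr 1
  refine Finset.prod_congr rfl fun x _ => ?_
  have e1 : mix (Sum.inr '' (S : Set Obs)) s v (Sum.inr x.1) = t x := by
    exact (mix_of_mem (Set.mem_image_of_mem _ x.2)).trans (withObs_inr t _ x)
  rw [kernel_eq_condColumn, e1]
  congr 1
  funext u
  exact hagree u (h.parents_subset x.1 x.2 u.2)

open Classical in
/-- A sum of `k` outer products for the joint tensor yields, on inverting the conditional
probability tables of the modes, a sum of `k` products for the matrix of the joint distribution of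
the parents. -/
lemma exists_bilinear (hdim : ∀ v, 2 ≤ dim v) (hp : IsPMF p) (hM : CausalMarkov G p)
    (hR : FullRank G p) {S : Finset Obs} {U : Set (Lat ⊕ Obs)} (h : IsLeafSet G S U)
    (hU : ∀ u ∈ U, ∃ x ∈ S, u ∈ parents G (Sum.inr x)) (R : Set Obs) {k : ℕ}
    {u : Fin k → ∀ x : S, Fin (dim (Sum.inr x.1)) → ℝ}
    (hu : ∀ t, jointTensor p S t = ∑ s, ∏ x, u s x (t x)) :
    ∃ (K : Config dim → Config dim → ℝ) (f g : Fin k → Config dim → ℝ),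
      (∀ v w, K v w = ∑ s, f s v * g s w) ∧
      ∀ v w, (∀ z : Config dim,
        (∀ x ∈ S, ∀ y ∈ parents G (Sum.inr x), (if x ∈ R then v y else w y) = z y) →
          K v w = marginal p U z) ∧
        ((¬ ∃ z : Config dim,
          ∀ x ∈ S, ∀ y ∈ parents G (Sum.inr x), (if x ∈ R then v y else w y) = z y) →
          K v w = 0) := by
  choose D hD using fun x : Obs => exists_dual_of_linearIndependent (hR x)
  -- Modes in `R` are contracted at the parent values in `v`, the others at those in `w`; hence the
  -- products split into a row and a column factor.
  let c : ∀ (v w : Config dim) (x : Obs) (y : parents G (Sum.inr x)), Fin (dim y) :=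
    fun v w x y => if x ∈ R then v y else w y
  let K : Config dim → Config dim → ℝ := fun v w =>
    ∑ t : (∀ x : S, Fin (dim (Sum.inr x.1))), jointTensor p S t * ∏ x : S, D x.1 (c v w x.1) (t x)
  let A : Fin k → Config dim → S → ℝ := fun s v x =>
    ∑ a, u s x a * D x.1 (fun y => v y) a
  -- By duality each column of the mixture turns into the indicator that `z` has the prescribed
  -- parent values.
  have hK : ∀ v w, agreeCount dim U * K v w = ∑ z : Config dim, marginal p U z *
      if ∀ x ∈ S, ∀ y ∈ parents G (Sum.inr x), (if x ∈ R then v y else w y) = z y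
      then 1 else 0 := by
    intro v w
    simp only [K]
    rw [Finset.mul_sum]
    simp only [← mul_assoc, agreeCount_mul_jointTensor hdim hp hM h, Finset.sum_mul]
    rw [Finset.sum_comm]
    refine Finset.sum_congr rfl fun z _ => ?_
    simp only [mul_assoc, ← Finset.prod_mul_distrib]
    rw [← Finset.mul_sum, ← Fintype.piFinset_univ, ← Finset.prod_univ_sum (fun _ => Finset.univ)
      (fun (x : S) a => condColumn G p (Sum.inr x.1) (fun u => z u) a * D x.1 (c v w x.1) a)]
    congr 1
    simp only [hD]
    split_ifs with hz
    · refine Finset.prod_eq_one fun x _ => if_pos ?_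
      funext y
      exact (hz x.1 x.2 y y.2).symm
    · push Not at hz
      obtain ⟨x, hx, y, hy, hne⟩ := hz
      refine Finset.prod_eq_zero (Finset.mem_univ (⟨x, hx⟩ : S)) (if_neg fun he => hne ?_)
      exact (congrFun he ⟨y, hy⟩).symm
  have hpos := agreeCount_pos hdim U
  refine ⟨K, fun s v => ∏ x : S, if x.1 ∈ R then A s v x else 1,
    fun s w => ∏ x : S, if x.1 ∈ R then 1 else A s w x, fun v w => ?_, fun v w => ⟨?_, ?_⟩⟩
  · simp only [K, hu, Finset.sum_mul]
    rw [Finset.sum_comm]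
    refine Finset.sum_congr rfl fun s _ => ?_
    simp only [← Finset.prod_mul_distrib]
    rw [← Fintype.piFinset_univ, ← Finset.prod_univ_sum (fun _ => Finset.univ)
      (fun (x : S) a => u s x a * D x.1 (c v w x.1) a)]
    refine Finset.prod_congr rfl fun x _ => ?_
    by_cases hx : x.1 ∈ R <;> simp [hx, A, c]
  · intro z hz
    refine mul_left_cancel₀ hpos.ne' ?_
    rw [hK, ← sum_agree U z, Finset.sum_mul]
    refine Finset.sum_congr (by ext; simp) fun z' _ => ?_
    -- Every variable in `U` is a parent of some mode, so the prescribed values determine `z'` on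
    -- all of `U`.
    have hiff : (∀ x ∈ S, ∀ y ∈ parents G (Sum.inr x), (if x ∈ R then v y else w y) = z' y) ↔
        ∀ y ∈ U, z y = z' y := by
      constructor
      · intro hz' y hy
        obtain ⟨x, hx, hxy⟩ := hU y hy
        rw [← hz x hx y hxy, hz' x hx y hxy]
      · intro hz' x hx y hy
        rw [hz x hx y hy, hz' y (h.parents_subset x hx hy)]
    simp only [hiff]
    split_ifs with hz'
    · rw [dependsOn_marginal p U hz']; ring
    · ring
  · intro hz
    refine mul_left_cancel₀ hpos.ne' ?_
    rw [hK, mul_zero]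
    refine Finset.sum_eq_zero fun z _ => ?_
    rw [if_neg fun hz' => hz ⟨z, hz'⟩, mul_zero]

end Tensor

/-! ### Pure children and latent configurations -/

section PureChildren

variable {Lat Obs : Type*} {dim : Lat ⊕ Obs → ℕ} {G : Digraph (Lat ⊕ Obs)}

lemma IsPureChild.parents_eq {x : Obs} {l : Lat} (h : IsPureChild G x l) :
    parents G (Sum.inr x) = {Sum.inl l} := Set.ext fun u => h.1 u

lemma IsPureChild.unique {x : Obs} {l l' : Lat} (h : IsPureChild G x l)
    (h' : IsPureChild G x l') : l = l' := by
  have := h.parents_eq.symm.trans h'.parents_eq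
  exact Sum.inl_injective (Set.singleton_injective this)

lemma IsChildSet.notMem {S : Finset Obs} {Lp : Finset Lat} (h : IsChildSet G S Lp) {x : Obs}
    {l : Lat} (hx : IsPureChild G x l) (hl : l ∉ Lp) : x ∉ S := by
  intro hxS
  obtain ⟨l', hl', h'⟩ := h.1 x hxS
  exact hl (hx.unique h' ▸ hl')

open Classical in
/-- The configuration with values `c` on the latent variables in `Lp`, and those of `v`
elsewhere. -/
def withLat {Lp : Finset Lat} (c : ∀ l : Lp, Fin (dim (Sum.inl l.1))) (v : Config dim) :
    Config dim
  | Sum.inl l => if h : l ∈ Lp then c ⟨l, h⟩ else v (Sum.inl l)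
  | Sum.inr x => v (Sum.inr x)

lemma withLat_inl {Lp : Finset Lat} (c : ∀ l : Lp, Fin (dim (Sum.inl l.1))) (v : Config dim)
    (l : Lp) : withLat c v (Sum.inl l.1) = c l := by
  simp [withLat]

lemma withLat_agree_iff {Lp : Finset Lat} {c c' : ∀ l : Lp, Fin (dim (Sum.inl l.1))}
    {v : Config dim} :
    (∀ l ∈ Lp, withLat c v (Sum.inl l) = withLat c' v (Sum.inl l)) ↔ c = c' := by
  refine ⟨fun h => funext fun l => ?_, fun h l _ => by rw [h]⟩
  have := h l.1 l.2
  rwa [withLat_inl, withLat_inl] at this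

end PureChildren

/-! ### Length of decompositions of block diagonal matrices -/

section MatrixBounds

variable {Lat Obs : Type*} {dim : Lat ⊕ Obs → ℕ} {Lp : Finset Lat}
  {K : Config dim → Config dim → ℝ} {k : ℕ} {f g : Fin k → Config dim → ℝ}

lemma card_latent_configs (Lp : Finset Lat) (dim : Lat ⊕ Obs → ℕ)
    [Fintype (∀ l : Lp, Fin (dim (Sum.inl l.1)))] :
    Fintype.card (∀ l : Lp, Fin (dim (Sum.inl l.1))) = ∏ l ∈ Lp, dim (Sum.inl l) := by
  rw [← Nat.card_eq_fintype_card, Nat.card_pi, ← Finset.prod_coe_sort Lp fun l => dim (Sum.inl l)]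
  exact Finset.prod_congr rfl fun l _ => Nat.card_eq_fintype_card.trans (Fintype.card_fin _)

/-- A matrix that is block diagonal, with one nonzero block for each value of `Lp`, has at least as
many terms in any decomposition as there are blocks. -/
lemma prod_dim_le (hdim : ∀ v, 2 ≤ dim v) (hK : ∀ v w, K v w = ∑ s, f s v * g s w)
    (h0 : ∀ v w : Config dim, (¬ ∀ l ∈ Lp, v (Sum.inl l) = w (Sum.inl l)) → K v w = 0)
    (h1 : ∀ v, K v v ≠ 0) : ∏ l ∈ Lp, dim (Sum.inl l) ≤ k := by
  classical
  let d : Config dim := fun v => ⟨0, by have := hdim v; omega⟩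
  rw [← card_latent_configs Lp dim]
  refine card_le_of_independent_rows hK (fun c => withLat c d) fun a ha c => ?_
  have h := ha (withLat c d)
  rw [Finset.sum_eq_single c] at h
  · exact (mul_eq_zero.mp h).resolve_right (h1 _)
  · intro c' _ hc
    rw [h0 _ _ (fun H => hc (withLat_agree_iff.mp H)), mul_zero]
  · simp

/-- If a block diagonal matrix has no more terms in a decomposition than blocks, then its blocks
have rank one. -/
lemma exchange_of_le (hdim : ∀ v, 2 ≤ dim v) (hK : ∀ v w, K v w = ∑ s, f s v * g s w)
    (h0 : ∀ v w : Config dim, (¬ ∀ l ∈ Lp, v (Sum.inl l) = w (Sum.inl l)) → K v w = 0)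
    (h1 : ∀ v, K v v ≠ 0) (hk : k ≤ ∏ l ∈ Lp, dim (Sum.inl l)) (v w : Config dim)
    (hvw : ∀ l ∈ Lp, v (Sum.inl l) = w (Sum.inl l)) : K v v * K w w = K v w * K w v := by
  classical
  by_contra hne
  let d : Config dim := fun v => ⟨0, by have := hdim v; omega⟩
  let c₀ : ∀ l : Lp, Fin (dim (Sum.inl l.1)) := fun l => v (Sum.inl l.1)
  -- One row from each block, `v` for its own block, and `w` as an extra row. If the minor on `v`
  -- and `w` were nonzero, these rows would be independent, one more than `k` allows.
  let e : Option (∀ l : Lp, Fin (dim (Sum.inl l.1))) → Config dim := fun o =>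
    o.elim w fun c => if c = c₀ then v else withLat c d
  have hcard : Fintype.card (Option (∀ l : Lp, Fin (dim (Sum.inl l.1)))) ≤ k := by
    refine card_le_of_independent_rows hK e fun a ha => ?_
    simp only [Fintype.sum_option, e, Option.elim] at ha
    have hc : ∀ c, c ≠ c₀ → a (some c) = 0 := by
      intro c hc
      have h := ha (withLat c d)
      rw [Finset.sum_eq_single c, if_neg hc, h0 w] at h
      · rw [mul_zero, zero_add] at h
        exact (mul_eq_zero.mp h).resolve_right (h1 _)
      · intro H
        refine hc (funext fun l => ?_)
        rw [← withLat_inl c d l, ← H l.1 l.2, ← hvw l.1 l.2]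
      · intro c' _ hc'
        rw [h0, mul_zero]
        intro H
        by_cases h' : c' = c₀
        · rw [if_pos h'] at H
          refine hc (funext fun l => ?_)
          rw [← withLat_inl c d l, ← H l.1 l.2]
        · rw [if_neg h'] at H
          exact hc' (withLat_agree_iff.mp H)
      · simp
    have hz : ∀ z, a none * K w z + a (some c₀) * K v z = 0 := by
      intro z
      have h := ha z
      rwa [Finset.sum_eq_single c₀ (fun c _ h' => by rw [hc c h', zero_mul]) (by simp),
        if_pos rfl] at h
    have hv := hz v
    have hw := hz w
    have hD : K v v * K w w - K v w * K w v ≠ 0 := sub_ne_zero.mpr hne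
    have e1 : a none = 0 := by
      refine (mul_eq_zero.mp ?_).resolve_right hD
      linear_combination K v v * hw - K v w * hv
    have e2 : a (some c₀) = 0 := by
      refine (mul_eq_zero.mp ?_).resolve_right hD
      linear_combination K w w * hv - K w v * hw
    rintro (_ | c)
    · exact e1
    · by_cases h : c = c₀
      · rw [h, e2]
      · exact hc c h
  rw [Fintype.card_option, card_latent_configs Lp dim] at hcard
  omega

end MatrixBounds

/-! ### Decompositions and conditional independence in the latent model -/

section LatentModel

lemma union_latents_subset_range {Lat Obs : Type*} (Li Lj : Lat) (Lp : Finset Lat) :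
    {Sum.inl Li} ∪ {Sum.inl Lj} ∪ Sum.inl '' (Lp : Set Lat) ⊆
      Set.range (Sum.inl : Lat → Lat ⊕ Obs) := by
  rintro _ ((rfl | rfl) | ⟨l, -, rfl⟩) <;> exact ⟨_, rfl⟩

variable {Lat Obs : Type*} [Fintype Lat] [Fintype Obs] {dim : Lat ⊕ Obs → ℕ}
  {G : Digraph (Lat ⊕ Obs)} {p : Config dim → ℝ} {Li Lj : Lat} {Lp : Finset Lat} {Xi Xj : Obs}
  {Xp1 Xp2 : Finset Obs} {k : ℕ}

lemma IsDiscreteLSM.marginal_pos (h : IsDiscreteLSM G p) {U : Set (Lat ⊕ Obs)}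
    (hU : U ⊆ Set.range Sum.inl) (s : Config dim) : 0 < marginal p U s :=
  (h.pos_latent s).trans_le (marginal_anti h.isPMF hU s)

lemma IsDiscreteLSM.ncard_support (h : IsDiscreteLSM G p) (v : Lat ⊕ Obs) :
    (support p v).ncard = dim v := by
  have : support p v = Set.univ := Set.eq_univ_of_forall fun a => h.pos v a
  rw [this, Set.ncard_univ, Nat.card_eq_fintype_card, Fintype.card_fin]

variable [DecidableEq Obs]

open Classical in
/-- A decomposition of the joint tensor yields one of the matrix of the joint distribution of `Li`
and `Lp` (rows) and `Lj` and `Lp` (columns). -/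
lemma exists_latent_bilinear (hLSM : IsDiscreteLSM G p) (hM : CausalMarkov G p)
    (hR : FullRank G p) (hij : Li ≠ Lj) (hi : Li ∉ Lp) (hj : Lj ∉ Lp)
    (hXi : IsPureChild G Xi Li) (hXj : IsPureChild G Xj Lj) (hdisj : Disjoint Xp1 Xp2)
    (hXp1 : IsChildSet G Xp1 Lp) (hXp2 : IsChildSet G Xp2 Lp)
    {u : Fin k → ∀ x : ({Xi, Xj} ∪ Xp1 ∪ Xp2 : Finset Obs), Fin (dim (Sum.inr x.1)) → ℝ}
    (hu : ∀ t, jointTensor p ({Xi, Xj} ∪ Xp1 ∪ Xp2) t = ∑ s, ∏ x, u s x (t x)) :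
    ∃ (K : Config dim → Config dim → ℝ) (f g : Fin k → Config dim → ℝ),
      (∀ v w, K v w = ∑ s, f s v * g s w) ∧
      ∀ v w, ((∀ l ∈ Lp, v (Sum.inl l) = w (Sum.inl l)) → K v w =
          marginal p ({Sum.inl Li} ∪ {Sum.inl Lj} ∪ Sum.inl '' (Lp : Set Lat))
            (Function.update v (Sum.inl Lj) (w (Sum.inl Lj)))) ∧
        ((¬ ∀ l ∈ Lp, v (Sum.inl l) = w (Sum.inl l)) → K v w = 0) := by
  have hpure : ∀ x ∈ ({Xi, Xj} ∪ Xp1 ∪ Xp2 : Finset Obs), ∃ l, IsPureChild G x l ∧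
      (Sum.inl l : Lat ⊕ Obs) ∈
        ({Sum.inl Li} ∪ {Sum.inl Lj} ∪ Sum.inl '' (Lp : Set Lat) : Set (Lat ⊕ Obs)) := by
    intro x hx
    simp only [Finset.mem_union, Finset.mem_insert, Finset.mem_singleton] at hx
    rcases hx with ((rfl | rfl) | hx) | hx
    · exact ⟨Li, hXi, by simp⟩
    · exact ⟨Lj, hXj, by simp⟩
    · obtain ⟨l, hl, h⟩ := hXp1.1 x hx
      exact ⟨l, h, by simp [hl]⟩
    · obtain ⟨l, hl, h⟩ := hXp2.1 x hx
      exact ⟨l, h, by simp [hl]⟩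
  have hleaf : IsLeafSet G ({Xi, Xj} ∪ Xp1 ∪ Xp2)
      ({Sum.inl Li} ∪ {Sum.inl Lj} ∪ Sum.inl '' (Lp : Set Lat)) := by
    refine ⟨fun x _ => by simp, fun x hx => ?_, fun x hx => ?_⟩
    · obtain ⟨l, h, hl⟩ := hpure x hx
      rw [h.parents_eq]
      exact Set.singleton_subset_iff.mpr hl
    · obtain ⟨l, h, hl⟩ := hpure x hx
      exact h.2
  have hcover : ∀ y ∈ ({Sum.inl Li} ∪ {Sum.inl Lj} ∪ Sum.inl '' (Lp : Set Lat) :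
      Set (Lat ⊕ Obs)), ∃ x ∈ ({Xi, Xj} ∪ Xp1 ∪ Xp2 : Finset Obs), y ∈ parents G (Sum.inr x) := by
    rintro _ ((rfl | rfl) | ⟨l, hl, rfl⟩)
    · exact ⟨Xi, by simp, by rw [hXi.parents_eq]; rfl⟩
    · exact ⟨Xj, by simp, by rw [hXj.parents_eq]; rfl⟩
    · obtain ⟨x, hx, h⟩ := hXp1.2 l hl
      exact ⟨x, by simp [hx], by rw [h.parents_eq]; rfl⟩
  -- Each member of `Lp` has a child in `Xp1`, read from `v`, and one in `Xp2`, read from `w`. A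
  -- consistent `z` therefore forces `v` and `w` to agree on `Lp`.
  obtain ⟨K, f, g, hK, hK'⟩ := exists_bilinear hLSM.two_le_dim hLSM.isPMF hM hR hleaf hcover
    (insert Xi (Xp1 : Set Obs)) hu
  have hXij : Xj ≠ Xi := by
    rintro rfl
    exact hij (hXi.unique hXj)
  have hXj1 : Xj ∉ Xp1 := hXp1.notMem hXj hj
  have hXi2 : Xi ∉ Xp2 := hXp2.notMem hXi hi
  refine ⟨K, f, g, hK, fun v w => ⟨fun hvw => (hK' v w).1 _ ?_, fun hvw => (hK' v w).2 ?_⟩⟩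
  · intro x hx y hy
    simp only [Finset.mem_union, Finset.mem_insert, Finset.mem_singleton] at hx
    rcases hx with ((rfl | rfl) | hx) | hx
    · rw [hXi.parents_eq] at hy
      obtain rfl : y = Sum.inl Li := hy
      rw [if_pos (Set.mem_insert _ _), Function.update_of_ne (by simpa using hij)]
    · rw [hXj.parents_eq] at hy
      obtain rfl : y = Sum.inl Lj := hy
      rw [if_neg (by simp [hXij, hXj1]), Function.update_self]
    · obtain ⟨l, hl, h⟩ := hXp1.1 x hx
      rw [h.parents_eq] at hy
      obtain rfl : y = Sum.inl l := hy
      rw [if_pos (Set.mem_insert_of_mem _ hx), Function.update_of_ne]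
      rintro h'
      exact hj (Sum.inl_injective h' ▸ hl)
    · obtain ⟨l, hl, h⟩ := hXp2.1 x hx
      rw [h.parents_eq] at hy
      obtain rfl : y = Sum.inl l := hy
      rw [if_neg, Function.update_of_ne, hvw l hl]
      · rintro h'
        exact hj (Sum.inl_injective h' ▸ hl)
      · rintro (rfl | hx')
        · exact hXi2 hx
        · exact Finset.disjoint_left.mp hdisj hx' hx
  · rintro ⟨z, hz⟩
    refine hvw fun l hl => ?_
    obtain ⟨x1, hx1, h1⟩ := hXp1.2 l hl
    obtain ⟨x2, hx2, h2⟩ := hXp2.2 l hl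
    have e1 := hz x1 (by simp [hx1]) (Sum.inl l) (by rw [h1.parents_eq]; rfl)
    have e2 := hz x2 (by simp [hx2]) (Sum.inl l) (by rw [h2.parents_eq]; rfl)
    rw [if_pos (Set.mem_insert_of_mem _ hx1)] at e1
    rw [if_neg] at e2
    · rw [e1, e2]
    · rintro (rfl | hx')
      · exact hXi2 hx2
      · exact Finset.disjoint_left.mp hdisj hx' hx2

/-- Every decomposition of the joint tensor has at least as many terms as `Lp` has values. -/
lemma prod_dim_le_of_decomposition (hLSM : IsDiscreteLSM G p) (hM : CausalMarkov G p)
    (hR : FullRank G p) (hij : Li ≠ Lj) (hi : Li ∉ Lp) (hj : Lj ∉ Lp)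
    (hXi : IsPureChild G Xi Li) (hXj : IsPureChild G Xj Lj) (hdisj : Disjoint Xp1 Xp2)
    (hXp1 : IsChildSet G Xp1 Lp) (hXp2 : IsChildSet G Xp2 Lp)
    {u : Fin k → ∀ x : ({Xi, Xj} ∪ Xp1 ∪ Xp2 : Finset Obs), Fin (dim (Sum.inr x.1)) → ℝ}
    (hu : ∀ t, jointTensor p ({Xi, Xj} ∪ Xp1 ∪ Xp2) t = ∑ s, ∏ x, u s x (t x)) :
    ∏ l ∈ Lp, dim (Sum.inl l) ≤ k := by
  obtain ⟨K, f, g, hK, hK'⟩ :=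
    exists_latent_bilinear hLSM hM hR hij hi hj hXi hXj hdisj hXp1 hXp2 hu
  refine prod_dim_le hLSM.two_le_dim hK (fun v w => (hK' v w).2) fun v => ?_
  rw [(hK' v v).1 fun _ _ => rfl]
  exact (hLSM.marginal_pos (union_latents_subset_range _ _ _) _).ne'

/-- If the joint tensor has a decomposition with no more terms than `Lp` has values, then `Li` and
`Lj` are independent given `Lp`. -/
lemma condIndep_of_decomposition (hLSM : IsDiscreteLSM G p) (hM : CausalMarkov G p)
    (hR : FullRank G p) (hij : Li ≠ Lj) (hi : Li ∉ Lp) (hj : Lj ∉ Lp)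
    (hXi : IsPureChild G Xi Li) (hXj : IsPureChild G Xj Lj) (hdisj : Disjoint Xp1 Xp2)
    (hXp1 : IsChildSet G Xp1 Lp) (hXp2 : IsChildSet G Xp2 Lp)
    {u : Fin k → ∀ x : ({Xi, Xj} ∪ Xp1 ∪ Xp2 : Finset Obs), Fin (dim (Sum.inr x.1)) → ℝ}
    (hu : ∀ t, jointTensor p ({Xi, Xj} ∪ Xp1 ∪ Xp2) t = ∑ s, ∏ x, u s x (t x))
    (hk : k ≤ ∏ l ∈ Lp, dim (Sum.inl l)) :
    CondIndep p {Sum.inl Li} {Sum.inl Lj} (Sum.inl '' (Lp : Set Lat)) := by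
  classical
  obtain ⟨K, f, g, hK, hK'⟩ :=
    exists_latent_bilinear hLSM hM hR hij hi hj hXi hXj hdisj hXp1 hXp2 hu
  have hpos := hLSM.marginal_pos (union_latents_subset_range Li Lj Lp)
  set m := marginal p ({Sum.inl Li} ∪ {Sum.inl Lj} ∪ Sum.inl '' (Lp : Set Lat)) with hm
  have hmdep : DependsOn m _ := dependsOn_marginal p _
  let d : Config dim := fun v => ⟨0, by have := hLSM.two_le_dim v; omega⟩
  have hexch := exchange_of_le (Lp := Lp) hLSM.two_le_dim hK (fun v w => (hK' v w).2)
    (fun v => by rw [(hK' v v).1 fun _ _ => rfl]; exact (hpos _).ne') hk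
  -- Resetting `Li` or `Lj` to a base value, the vanishing minor reads `m s * m (sj (si s)) = m (sj
  -- s) * m (si s)`, which gives the factorization of `m`.
  let si : Config dim → Config dim := fun s => Function.update s (Sum.inl Li) (d (Sum.inl Li))
  let sj : Config dim → Config dim := fun s => Function.update s (Sum.inl Lj) (d (Sum.inl Lj))
  have hne : (Sum.inl Li : Lat ⊕ Obs) ≠ Sum.inl Lj := by simpa using hij
  have hiC : (Sum.inl Li : Lat ⊕ Obs) ∉ (Sum.inl '' (Lp : Set Lat) : Set (Lat ⊕ Obs)) := by
    simpa using hi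
  have hjC : (Sum.inl Lj : Lat ⊕ Obs) ∉ (Sum.inl '' (Lp : Set Lat) : Set (Lat ⊕ Obs)) := by
    simpa using hj
  refine condIndep_of_factor hLSM.two_le_dim (by simpa using hij) (by simpa using hi)
    (by simpa using hj) (F := fun s => m (sj s)) (H := fun s => m (si s) / m (sj (si s))) ?_ ?_ ?_
  · intro s t hst
    refine hmdep fun y hy => ?_
    by_cases hyj : y = Sum.inl Lj
    · subst hyj; simp only [sj, Function.update_self]
    · simp only [sj, Function.update_of_ne hyj]
      rcases hy with (hy | hy) | hy
      · exact hst _ (Or.inl hy)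
      · exact absurd hy hyj
      · exact hst _ (Or.inr hy)
  · intro s t hst
    have h : ∀ y ∈ ({Sum.inl Li} ∪ {Sum.inl Lj} ∪ Sum.inl '' (Lp : Set Lat) : Set (Lat ⊕ Obs)),
        si s y = si t y := by
      intro y hy
      by_cases hyi : y = Sum.inl Li
      · subst hyi; simp only [si, Function.update_self]
      · simp only [si, Function.update_of_ne hyi]
        rcases hy with (hy | hy) | hy
        · exact absurd hy hyi
        · exact hst _ (Or.inl hy)
        · exact hst _ (Or.inr hy)
    have h' : m (sj (si s)) = m (sj (si t)) := by
      refine hmdep fun y hy => ?_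
      by_cases hyj : y = Sum.inl Lj
      · subst hyj; simp only [sj, Function.update_self]
      · simp only [sj, Function.update_of_ne hyj, h y hy]
    simp only [hmdep h, h']
  · intro s
    have hag : ∀ l ∈ Lp, s (Sum.inl l) = sj (si s) (Sum.inl l) := by
      intro l hl
      have h1 : (Sum.inl l : Lat ⊕ Obs) ≠ Sum.inl Li := fun h => hi (Sum.inl_injective h ▸ hl)
      have h2 : (Sum.inl l : Lat ⊕ Obs) ≠ Sum.inl Lj := fun h => hj (Sum.inl_injective h ▸ hl)
      simp only [si, sj, Function.update_of_ne h1, Function.update_of_ne h2]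
    have h := hexch s (sj (si s)) hag
    rw [(hK' s s).1 fun _ _ => rfl, (hK' (sj (si s)) (sj (si s))).1 fun _ _ => rfl,
      (hK' _ _).1 hag, (hK' _ _).1 fun l hl => (hag l hl).symm, Function.update_eq_self,
      Function.update_eq_self] at h
    have e1 : Function.update s (Sum.inl Lj) (sj (si s) (Sum.inl Lj)) = sj s := by
      simp [sj]
    have e2 : Function.update (sj (si s)) (Sum.inl Lj) (s (Sum.inl Lj)) = si s := by
      simp only [sj, Function.update_idem]
      rw [show s (Sum.inl Lj) = si s (Sum.inl Lj) from (Function.update_of_ne hne.symm _ _).symm,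
        Function.update_eq_self]
    rw [e1, e2] at h
    rw [← mul_div_assoc, eq_div_iff (hpos _).ne']
    exact h

/-- If `Li` and `Lj` are independent given `Lp`, then so are their pure children. -/
lemma condIndep_children (hLSM : IsDiscreteLSM G p) (hM : CausalMarkov G p)
    (hij : Li ≠ Lj) (hi : Li ∉ Lp) (hj : Lj ∉ Lp)
    (hXi : IsPureChild G Xi Li) (hXj : IsPureChild G Xj Lj)
    (h : CondIndep p {Sum.inl Li} {Sum.inl Lj} (Sum.inl '' (Lp : Set Lat))) :
    CondIndep p {Sum.inr Xi} {Sum.inr Xj} (Sum.inl '' (Lp : Set Lat)) := by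
  have hXij : Xi ≠ Xj := by
    rintro rfl
    exact hij (hXi.unique hXj)
  have hCpos := hLSM.marginal_pos
    (show Sum.inl '' (Lp : Set Lat) ⊆ Set.range Sum.inl by rintro _ ⟨l, -, rfl⟩; exact ⟨l, rfl⟩)
  have hleaf : IsLeafSet G {Xi, Xj}
      ({Sum.inl Li} ∪ {Sum.inl Lj} ∪ Sum.inl '' (Lp : Set Lat)) := by
    refine ⟨fun x _ => by simp, fun x hx => ?_, fun x hx => ?_⟩ <;>
      rw [Finset.mem_insert, Finset.mem_singleton] at hx <;> rcases hx with rfl | rfl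
    · rw [hXi.parents_eq]; simp
    · rw [hXj.parents_eq]; simp
    · exact hXi.2
    · exact hXj.2
  have hAB : Disjoint ({Sum.inr Xi, Sum.inl Li} : Set (Lat ⊕ Obs)) {Sum.inr Xj, Sum.inl Lj} := by
    simp [hXij.symm, hij.symm]
  -- The pairs of a child and its latent parent are independent given `Lp`; the parents are then
  -- dropped.
  refine CondIndep.mono hLSM.two_le_dim (A := {Sum.inr Xi, Sum.inl Li})
    (B := {Sum.inr Xj, Sum.inl Lj}) ?_ (by simp) (by simp) hAB
  refine condIndep_of_factor hLSM.two_le_dim hAB (by simpa using hi) (by simpa using hj)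
    (F := fun s => marginal p ({Sum.inl Li} ∪ Sum.inl '' (Lp : Set Lat)) s /
      marginal p (Sum.inl '' (Lp : Set Lat)) s * kernel G p (Sum.inr Xi) s)
    (H := fun s => marginal p ({Sum.inl Lj} ∪ Sum.inl '' (Lp : Set Lat)) s *
      kernel G p (Sum.inr Xj) s) ?_ ?_ ?_
  · intro s t hst
    simp only
    rw [dependsOn_marginal p _ fun y hy => hst y ?_, dependsOn_marginal p
      (Sum.inl '' (Lp : Set Lat)) fun y hy => hst y (Or.inr hy),
      dependsOn_kernel G p _ fun y hy => hst y ?_]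
    · rw [hXi.parents_eq] at hy
      exact Or.inl hy
    · exact Set.union_subset_union_left _ (by simp) hy
  · intro s t hst
    simp only
    rw [dependsOn_marginal p _ fun y hy => hst y ?_, dependsOn_kernel G p _ fun y hy => hst y ?_]
    · rw [hXj.parents_eq] at hy
      exact Or.inl hy
    · exact Set.union_subset_union_left _ (by simp) hy
  · intro s
    have e : ({Sum.inr Xi, Sum.inl Li} ∪ {Sum.inr Xj, Sum.inl Lj} ∪ Sum.inl '' (Lp : Set Lat) :
        Set (Lat ⊕ Obs)) = {Sum.inl Li} ∪ {Sum.inl Lj} ∪ Sum.inl '' (Lp : Set Lat) ∪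
          Sum.inr '' (({Xi, Xj} : Finset Obs) : Set Obs) := by
      ext y
      simp only [Set.mem_union, Set.mem_insert_iff, Set.mem_singleton_iff, Finset.coe_insert,
        Finset.coe_singleton, Set.image_insert_eq, Set.image_singleton]
      tauto
    rw [e, marginal_union_leaves hLSM.two_le_dim hLSM.isPMF hM hleaf, Finset.prod_pair hXij]
    have := h s
    have hC := (hCpos s).ne'
    field_simp
    linear_combination kernel G p (Sum.inr Xi) s * kernel G p (Sum.inr Xj) s * this

/-- If `Li` and `Lj` are independent given `Lp`, then the joint tensor has a decomposition with one
term for each value of `Lp`. -/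
lemma exists_decomposition (hLSM : IsDiscreteLSM G p) (hM : CausalMarkov G p)
    (hij : Li ≠ Lj) (hi : Li ∉ Lp) (hj : Lj ∉ Lp)
    (hXi : IsPureChild G Xi Li) (hXj : IsPureChild G Xj Lj)
    (hXp1 : IsChildSet G Xp1 Lp) (hXp2 : IsChildSet G Xp2 Lp)
    (h : CondIndep p {Sum.inl Li} {Sum.inl Lj} (Sum.inl '' (Lp : Set Lat))) :
    ∃ u : Fin (∏ l ∈ Lp, dim (Sum.inl l)) →
        ∀ x : ({Xi, Xj} ∪ Xp1 ∪ Xp2 : Finset Obs), Fin (dim (Sum.inr x.1)) → ℝ,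
      ∀ t, jointTensor p ({Xi, Xj} ∪ Xp1 ∪ Xp2) t = ∑ s, ∏ x, u s x (t x) := by
  classical
  have hXij : Xi ≠ Xj := by
    rintro rfl
    exact hij (hXi.unique hXj)
  have hCI := condIndep_children hLSM hM hij hi hj hXi hXj h
  have hCpos := hLSM.marginal_pos
    (show Sum.inl '' (Lp : Set Lat) ⊆ Set.range Sum.inl by rintro _ ⟨l, -, rfl⟩; exact ⟨l, rfl⟩)
  have hQ : ∀ x ∈ Xp1 ∪ Xp2, ∃ l ∈ Lp, IsPureChild G x l := fun x hx =>
    (Finset.mem_union.mp hx).elim (hXp1.1 x) (hXp2.1 x)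
  have hiQ : Xi ∉ Xp1 ∪ Xp2 := fun hx =>
    (Finset.mem_union.mp hx).elim (hXp1.notMem hXi hi) (hXp2.notMem hXi hi)
  have hjQ : Xj ∉ Xp1 ∪ Xp2 := fun hx =>
    (Finset.mem_union.mp hx).elim (hXp1.notMem hXj hj) (hXp2.notMem hXj hj)
  have hleaf : IsLeafSet G (Xp1 ∪ Xp2)
      ({Sum.inr Xi} ∪ {Sum.inr Xj} ∪ Sum.inl '' (Lp : Set Lat)) := by
    refine ⟨fun x hx => ?_, fun x hx => ?_, fun x hx => ?_⟩
    · rintro ((h | h) | ⟨l, -, h⟩)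
      · exact hiQ (Sum.inr_injective h ▸ hx)
      · exact hjQ (Sum.inr_injective h ▸ hx)
      · cases h
    · obtain ⟨l, hl, h⟩ := hQ x hx
      rw [h.parents_eq]
      exact Set.singleton_subset_iff.mpr (Or.inr ⟨l, hl, rfl⟩)
    · obtain ⟨l, hl, h⟩ := hQ x hx
      exact h.2
  let d : Config dim := fun v => ⟨0, by have := hLSM.two_le_dim v; omega⟩
  -- The weight `ℙ(Lp)` has to sit in one mode: `Xj` takes the joint probability with `Lp`, all
  -- other modes conditional ones.
  let φ : Obs → Config dim → ℝ := fun x s =>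
    if x = Xi then marginal p ({Sum.inr Xi} ∪ Sum.inl '' (Lp : Set Lat)) s /
      marginal p (Sum.inl '' (Lp : Set Lat)) s
    else if x = Xj then marginal p ({Sum.inr Xj} ∪ Sum.inl '' (Lp : Set Lat)) s
    else kernel G p (Sum.inr x) s
  have hφ : ∀ x ∈ ({Xi, Xj} ∪ Xp1 ∪ Xp2 : Finset Obs),
      DependsOn (φ x) ({Sum.inr x} ∪ Sum.inl '' (Lp : Set Lat)) := by
    intro x hx s t hst
    simp only [φ]
    split_ifs with h1 h2
    · subst h1
      rw [dependsOn_marginal p _ hst,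
        dependsOn_marginal p (Sum.inl '' (Lp : Set Lat)) fun y hy => hst y (Or.inr hy)]
    · subst h2
      exact dependsOn_marginal p _ hst
    · have hxQ : x ∈ Xp1 ∪ Xp2 := by
        simp only [Finset.mem_union, Finset.mem_insert, Finset.mem_singleton] at hx ⊢
        tauto
      obtain ⟨l, hl, h⟩ := hQ x hxQ
      refine dependsOn_kernel G p _ fun y hy => hst y ?_
      rw [h.parents_eq] at hy
      rcases hy with rfl | rfl
      · exact Or.inl rfl
      · exact Or.inr ⟨l, hl, rfl⟩
  have hprod : ∀ s, marginal p (Sum.inl '' (Lp : Set Lat) ∪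
      Sum.inr '' (({Xi, Xj} ∪ Xp1 ∪ Xp2 : Finset Obs) : Set Obs)) s =
        ∏ x ∈ {Xi, Xj} ∪ Xp1 ∪ Xp2, φ x s := by
    intro s
    have e : (Sum.inl '' (Lp : Set Lat) ∪
        Sum.inr '' (({Xi, Xj} ∪ Xp1 ∪ Xp2 : Finset Obs) : Set Obs) : Set (Lat ⊕ Obs)) =
        {Sum.inr Xi} ∪ {Sum.inr Xj} ∪ Sum.inl '' (Lp : Set Lat) ∪
          Sum.inr '' ((Xp1 ∪ Xp2 : Finset Obs) : Set Obs) := by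
      simp only [Finset.coe_union, Finset.coe_insert, Finset.coe_singleton, Set.image_union,
        Set.image_insert_eq, Set.image_singleton]
      ext y
      simp only [Set.mem_union, Set.mem_insert_iff, Set.mem_singleton_iff]
      tauto
    have hdQ : Disjoint ({Xi, Xj} : Finset Obs) (Xp1 ∪ Xp2) := by
      rw [Finset.disjoint_left]
      intro x hx
      rw [Finset.mem_insert, Finset.mem_singleton] at hx
      rcases hx with rfl | rfl
      exacts [hiQ, hjQ]
    rw [e, marginal_union_leaves hLSM.two_le_dim hLSM.isPMF hM hleaf, Finset.union_assoc,
      Finset.prod_union hdQ, Finset.prod_pair hXij]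
    congr 1
    · simp only [φ, if_true, if_neg hXij.symm]
      rw [div_mul_eq_mul_div, eq_div_iff (hCpos s).ne']
      exact hCI s
    · refine Finset.prod_congr rfl fun x hx => ?_
      simp only [φ]
      rw [if_neg, if_neg]
      · rintro rfl; exact hjQ hx
      · rintro rfl; exact hiQ hx
  let eqv := (Fintype.equivFinOfCardEq (card_latent_configs Lp dim)).symm
  -- The default `d` is harmless, as `φ x` depends on `x` and `Lp` alone.
  refine ⟨fun s x a => φ x.1 (Function.update (withLat (eqv s) d) (Sum.inr x.1) a), fun t => ?_⟩
  rw [Equiv.sum_comp eqv fun c => ∏ x : ({Xi, Xj} ∪ Xp1 ∪ Xp2 : Finset Obs),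
    φ x.1 (Function.update (withLat c d) (Sum.inr x.1) (t x))]
  unfold jointTensor
  rw [prob_eq_sum_prob fun v (l : Lp) => v (Sum.inl l.1)]
  refine Finset.sum_congr rfl fun c _ => ?_
  have e1 : prob p (fun v => (∀ x : ({Xi, Xj} ∪ Xp1 ∪ Xp2 : Finset Obs),
      v (Sum.inr x.1) = t x) ∧ (fun l : Lp => v (Sum.inl l.1)) = c) =
      marginal p (Sum.inl '' (Lp : Set Lat) ∪
        Sum.inr '' (({Xi, Xj} ∪ Xp1 ∪ Xp2 : Finset Obs) : Set Obs)) (withObs t (withLat c d)) := by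
    refine prob_congr fun v => ⟨?_, fun hv => ⟨fun x => ?_, funext fun l => ?_⟩⟩
    · rintro ⟨h1, h2⟩ _ (⟨l, hl, rfl⟩ | ⟨x, hx, rfl⟩)
      · rw [withObs_inl, withLat_inl c d ⟨l, hl⟩, ← h2]
      · rw [withObs_inr t _ ⟨x, hx⟩, ← h1]
    · rw [hv _ (Or.inr ⟨x.1, x.2, rfl⟩), withObs_inr]
    · rw [hv _ (Or.inl ⟨l.1, l.2, rfl⟩), withObs_inl, withLat_inl]
  rw [e1, hprod, ← Finset.prod_coe_sort]
  refine Finset.prod_congr rfl fun x _ => hφ x.1 x.2 ?_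
  rintro _ (rfl | ⟨l, hl, rfl⟩)
  · rw [withObs_inr, Function.update_self]
  · rw [withObs_inl, Function.update_of_ne (by simp)]

end LatentModel

end

end DiscreteLatent

/-! ### The rank criterion -/

namespace DiscreteLatent

/-- `Li` and `Lj` are independent given `Lp` if and only if the rank of the joint tensor of their
children is the number of values of `Lp`. -/
theorem condIndep_iff_tensorRank_eq {Lat Obs : Type*} [Fintype Lat] [Fintype Obs]
    [DecidableEq Obs] {dim : Lat ⊕ Obs → ℕ} {G : Digraph (Lat ⊕ Obs)} {p : Config dim → ℝ}
    {Li Lj : Lat} {Lp : Finset Lat} {Xi Xj : Obs} {Xp1 Xp2 : Finset Obs}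
    (hLSM : IsDiscreteLSM G p) (hM : CausalMarkov G p) (hR : FullRank G p) (hij : Li ≠ Lj)
    (hi : Li ∉ Lp) (hj : Lj ∉ Lp) (hXi : IsPureChild G Xi Li) (hXj : IsPureChild G Xj Lj)
    (hdisj : Disjoint Xp1 Xp2) (hXp1 : IsChildSet G Xp1 Lp) (hXp2 : IsChildSet G Xp2 Lp) :
    CondIndep p {Sum.inl Li} {Sum.inl Lj} (Sum.inl '' (Lp : Set Lat)) ↔
      tensorRank (jointTensor p ({Xi, Xj} ∪ Xp1 ∪ Xp2)) =
        ∏ l ∈ Lp, (support p (Sum.inl l)).ncard := by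
  simp only [hLSM.ncard_support]
  constructor
  · intro h
    have hmem := exists_decomposition hLSM hM hij hi hj hXi hXj hXp1 hXp2 h
    refine le_antisymm (Nat.sInf_le hmem) (le_csInf ⟨_, hmem⟩ ?_)
    rintro k ⟨u, hu⟩
    exact prod_dim_le_of_decomposition hLSM hM hR hij hi hj hXi hXj hdisj hXp1 hXp2 hu
  · intro h
    -- `sInf ∅ = 0`, so a positive rank is attained by an actual decomposition.
    have hpos : 0 < ∏ l ∈ Lp, dim (Sum.inl l) :=
      Finset.prod_pos fun l _ => lt_of_lt_of_le two_pos (hLSM.two_le_dim _)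
    obtain ⟨u, hu⟩ := Nat.sInf_mem (Nat.nonempty_of_pos_sInf (h ▸ hpos))
    exact condIndep_of_decomposition hLSM hM hR hij hi hj hXi hXj hdisj hXp1 hXp2 hu h.le

end DiscreteLatent

theorem mainTheorem9 {Lat Obs : Type*} [Fintype Lat] [Fintype Obs] [DecidableEq Obs]
    {dim : Lat ⊕ Obs → ℕ} (G : Digraph (Lat ⊕ Obs)) (p : DiscreteLatent.Config dim → ℝ)
    (hLSM : DiscreteLatent.IsDiscreteLSM G p)
    (hMarkov : DiscreteLatent.CausalMarkov G p)
    (hFaithful : DiscreteLatent.Faithful G p)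
    (hFullRank : DiscreteLatent.FullRank G p)
    (Li Lj : Lat) (Lp : Finset Lat) (hij : Li ≠ Lj) (hi : Li ∉ Lp) (hj : Lj ∉ Lp)
    (Xi Xj : Obs) (hXi : DiscreteLatent.IsPureChild G Xi Li)
    (hXj : DiscreteLatent.IsPureChild G Xj Lj)
    (Xp1 Xp2 : Finset Obs) (hdisj : Disjoint Xp1 Xp2)
    (hXp1 : DiscreteLatent.IsChildSet G Xp1 Lp) (hXp2 : DiscreteLatent.IsChildSet G Xp2 Lp)
    (hcard1 : Xp1.card = Lp.card) (hcard2 : Xp2.card = Lp.card) :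
    (DiscreteLatent.CondIndep p {Sum.inl Li} {Sum.inl Lj} (Sum.inl '' (Lp : Set Lat)) ↔
      DiscreteLatent.tensorRank (DiscreteLatent.jointTensor p ({Xi, Xj} ∪ Xp1 ∪ Xp2)) =
        ∏ l ∈ Lp, (DiscreteLatent.support p (Sum.inl l)).ncard) ∧
    (DiscreteLatent.DSep G {Sum.inl Li} {Sum.inl Lj} (Sum.inl '' (Lp : Set Lat)) ↔
      DiscreteLatent.tensorRank (DiscreteLatent.jointTensor p ({Xi, Xj} ∪ Xp1 ∪ Xp2)) =
        ∏ l ∈ Lp, (DiscreteLatent.support p (Sum.inl l)).ncard) := by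
  have hmain := DiscreteLatent.condIndep_iff_tensorRank_eq hLSM hMarkov hFullRank hij hi hj hXi hXj
    hdisj hXp1 hXp2
  -- Soundness of d-separation yields the rank equality; faithfulness yields the converse.
  refine ⟨hmain, fun h => hmain.mp ?_, fun h => hFaithful _ _ _ ?_ ?_ ?_ (hmain.mpr h)⟩
  · exact DiscreteLatent.condIndep_of_dSep hLSM.two_le_dim hLSM.acyclic hLSM.isPMF hMarkov
      (by simpa using hi) (by simpa using hj) h
  · simpa using hij
  · simpa using hi
  · simpa using hj
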